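/- All graphs are finite and simple. Let $L$ be a set of integers, each at least $3$. A graph $G$ is an $L$-cycle graph if the length of every cycle of $G$ belongs to $L$. A block of $G$ is a maximal connected subgraph without a cutvertex; a $2$-connected block is a block with at least three vertices. For $r\ge 1$ the theta graph $T_{r,\ell}$ is the graph that consists of $r$ paths of length $\ell$ joining two vertices $u\ne v$, any two of which have only $u$ and $v$ in common. For $\ell\ge 2$ and $2k+1>2\ell$, the class $\mathcal{C}(2k+1,2\ell)$ consists of the graphs obtained as follows: take a cycle of length $2k+1$ with vertices $1,2,\dots,2k+1$ in cyclic order, choose $s\ge 0$ vertices $i_1<\dots<i_s$ that are pairwise at distance at least $\ell$ on the cycle, and for each $j$ add an arbitrary number of paths of length $\ell$ from $i_j$ to $i_j+\ell$ (modulo $2k+1$), where the $\ell-1$ inner vertices of each added path are new vertices. Then the following hold. (a) Let $L$ be a set of odd integers, each at least $3$. If $G$ is an $L$-cycle graph, then each $2$-connected block of $G$ is a cycle with length in $L$. (b) Let $k\ge 2$ and let $G$ be a $\{2k\}$-cycle graph. Then every $2$-connected block of $G$ is a $T_{r,k}$ for some $r\ge 2$. (c) Let $\ell\ge 2$ and $2k+1>2\ell$,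 and let $G$ be a $\{2k+1,2\ell\}$-cycle graph. Then every $2$-connected block of $G$ is a $T_{r,\ell}$ for some $r\ge 2$ or a graph in $\mathcal{C}(2k+1,2\ell)$. -/

import Mathlib

/-- `G` is an `L`-cycle graph: every cycle of `G` has its length in `L`. -/
def IsLCycleGraph {V : Type*} (G : SimpleGraph V) (L : Set ℕ) : Prop :=
  ∀ (v : V) (c : G.Walk v v), c.IsCycle → c.length ∈ L

/-- `v` is a cutvertex of `G`: two vertices other than `v` lie in the same component of `G`
but in different components of `G - v`. -/
def IsCutvertex {V : Type*} (G : SimpleGraph V) (v : V) : Prop :=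
  ∃ x y : ({v}ᶜ : Set V), G.Reachable (x : V) (y : V) ∧ ¬ (G.induce {v}ᶜ).Reachable x y

/-- A block of `G`: a maximal connected subgraph without a cutvertex (of its own). -/
def IsBlock {V : Type*} {G : SimpleGraph V} (B : G.Subgraph) : Prop :=
  Maximal (fun H : G.Subgraph => H.coe.Connected ∧ ∀ v, ¬ IsCutvertex H.coe v) B

/-- A graph is 2-connected if it has at least three vertices, is connected and has no
cutvertex. -/
def IsTwoConnected {V : Type*} (G : SimpleGraph V) : Prop :=
  3 ≤ ENat.card V ∧ G.Connected ∧ ∀ v, ¬ IsCutvertex G v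

/-- A 2-connected block, i.e. a block that is neither a single vertex nor a single edge. -/
def IsTwoConnectedBlock {V : Type*} {G : SimpleGraph V} (B : G.Subgraph) : Prop :=
  IsBlock B ∧ IsTwoConnected B.coe

/-- The graph `B` is a cycle of length `m`. -/
def IsCycleOfLength {V : Type*} {G : SimpleGraph V} (B : G.Subgraph) (m : ℕ) : Prop :=
  ∃ (v : V) (c : G.Walk v v), c.IsCycle ∧ c.length = m ∧ B = c.toSubgraph

/-- The graph `B` is a theta graph `T_{r,ℓ}`: it consists of `r` distinct paths of length `ℓ`
joining two vertices `u` and `v`, any two of which meet only in `u` and `v`. -/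
def IsTheta {V : Type*} {G : SimpleGraph V} (B : G.Subgraph) (r ℓ : ℕ) : Prop :=
  ∃ (u v : V) (p : Fin r → G.Walk u v),
    u ≠ v ∧
    (∀ a, (p a).IsPath ∧ (p a).length = ℓ) ∧
    Function.Injective p ∧
    (∀ a b, a ≠ b → ∀ x, x ∈ (p a).support → x ∈ (p b).support → x = u ∨ x = v) ∧
    B = ⨆ a, (p a).toSubgraph

/-- The graph `B` arises from a cycle `c` of length `m` as follows. The vertices of the cycle are
`c.getVert 0, …, c.getVert (m - 1)` in cyclic order. Take a set `s` of positions on the cycle, any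
two of them at distance at least `ℓ` along the cycle in both directions. For each `i ∈ s`, add an
arbitrary number `r i` of paths of length `ℓ` from the vertex in position `i` to the one in
position `i + ℓ` (modulo `m`). The inner vertices of each added path are new: they lie neither on
the cycle nor on another added path. Intended for `2 ≤ ℓ` and `2 * ℓ < m`; the cycles of such a
graph have lengths `m` and `2 * ℓ` only. -/
def IsCycleWithThetas {V : Type*} {G : SimpleGraph V} (B : G.Subgraph) (m ℓ : ℕ) : Prop :=
  ∃ (v : V) (c : G.Walk v v) (s : Finset ℕ) (r : s → ℕ)
    (p : ∀ i : s, Fin (r i) → G.Walk (c.getVert i) (c.getVert ((i + ℓ) % m))),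
    c.IsCycle ∧ c.length = m ∧
    (∀ i ∈ s, i < m) ∧
    (∀ i ∈ s, ∀ j ∈ s, i < j → i + ℓ ≤ j ∧ j + ℓ ≤ i + m) ∧
    (∀ i a, (p i a).IsPath ∧ (p i a).length = ℓ) ∧
    (∀ i a x, x ∈ (p i a).support → x ∈ c.support →
      x = c.getVert i ∨ x = c.getVert ((i + ℓ) % m)) ∧
    (∀ i a j b, (⟨i, a⟩ : Σ i : s, Fin (r i)) ≠ ⟨j, b⟩ →
      ∀ x, x ∈ (p i a).support → x ∈ (p j b).support → x ∈ c.support) ∧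
    B = c.toSubgraph ⊔ ⨆ i, ⨆ a, (p i a).toSubgraph

/-! Fix a cycle `c` in a 2-connected graph `B`. An ear `q` of `c` splits `c` into arcs of lengths
`d` and `|c| - d`, and closing `q` with each arc gives cycles whose lengths sum to `2|q| + |c|`.
Parity then decides everything. (a) If all cycles are odd, this sum is odd, so one of the two cycles
is even. Hence `c` has no ear and is all of `B`. (b), (c) Let `c` have length `2ℓ`, or odd length
above `2ℓ`, with only these two lengths occurring. Then each ear has length `ℓ` and spans an arc of
length `ℓ` (`IsEarCycle.ear`). Longer combinations are excluded by the same counting: ears meeting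
off `c` coincide up to reversal (`ear_unique`, from `not_star` and the girth), and the ends of two
ears never interleave on `c` (`not_cross`). Finally `B` is the union of `c` and its ears
(`Subgraph.eq_of_ears_le`): an ear of that union would extend along existing ears to a new ear of
`c`. If `|c| = 2ℓ`, all ears join one antipodal pair, which gives a theta graph. If `|c|` is odd,
noncrossing keeps the starting positions of the ears at distance at least `ℓ`. In (c), a block
without a cycle of length `2k+1` falls under the even case. -/

namespace SimpleGraph.Walk

variable {V : Type*} {G : SimpleGraph V}

/-! ### Paths, cycles and arcs -/

lemma IsPath.append_of_inter {u v w : V} {p : G.Walk u v} {q : G.Walk v w} (hp : p.IsPath)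
    (hq : q.IsPath) (h : ∀ x ∈ p.support, x ∈ q.support → x = v) : (p.append q).IsPath := by
  rw [isPath_def, support_append, List.nodup_append']
  refine ⟨hp.support_nodup, hq.support_nodup.tail, ?_⟩
  intro x hx hx'
  have hv := h x hx (List.mem_of_mem_tail hx')
  subst hv
  have := hq.support_nodup
  rw [← q.cons_tail_support] at this
  exact (List.nodup_cons.mp this).1 hx'

lemma IsPath.inter_of_append {u v w : V} {p : G.Walk u v} {q : G.Walk v w}
    (h : (p.append q).IsPath) {x : V} (hp : x ∈ p.support) (hq : x ∈ q.support) : x = v := by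
  by_contra hne
  exact h.ne_of_mem_support_of_append hne hp hq rfl

/-- Two distinct internally disjoint paths with the same ends form a cycle. -/
lemma IsPath.isCycle_append_reverse {u v : V} {p q : G.Walk u v} (hp : p.IsPath) (hq : q.IsPath)
    (huv : u ≠ v) (hpq : p ≠ q) (h : ∀ x ∈ p.support, x ∈ q.support → x = u ∨ x = v) :
    (p.append q.reverse).IsCycle := by
  refine hp.isCycle_append (isPath_reverse_iff q |>.mpr hq) (fun x hx hx' ↦ ?_) ?_
  · have h1 := hp.support_nodup
    rw [← p.cons_tail_support] at h1
    have h2 := hq.reverse.support_nodup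
    rw [← q.reverse.cons_tail_support] at h2
    rcases h x (List.mem_of_mem_tail hx) (by simpa using List.mem_of_mem_tail hx') with rfl | rfl
    · exact (List.nodup_cons.mp h1).1 hx
    · exact (List.nodup_cons.mp h2).1 hx'
  -- If both paths had length one, they would be the same edge.
  · by_contra! hlen
    simp only [length_reverse] at hlen
    apply hpq
    have hp0 : p.length ≠ 0 := fun h0 => huv (eq_of_length_eq_zero h0)
    have hq0 : q.length ≠ 0 := fun h0 => huv (eq_of_length_eq_zero h0)
    have hp1 : p.length = 1 := by omega
    have hq1 : q.length = 1 := by omega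
    apply ext_getVert_le_length (by omega)
    intro k hk
    rcases Nat.le_one_iff_eq_zero_or_eq_one.mp (hp1 ▸ hk) with rfl | rfl
    · simp
    · rw [← hp1, getVert_length, hp1, ← hq1, getVert_length]

/-- In a graph of girth at least `2 * ℓ`, distinct paths of length at most `ℓ` with common ends
are internally disjoint. -/
lemma IsPath.inter_of_length_le {ℓ : ℕ} (hG : ∀ (v : V) (c : G.Walk v v), c.IsCycle → 2 * ℓ ≤ c.length)
    {u v : V} {p q : G.Walk u v} (hp : p.IsPath) (hq : q.IsPath) (hpl : p.length ≤ ℓ)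
    (hql : q.length ≤ ℓ) (hpq : p ≠ q) {x : V} (hxp : x ∈ p.support) (hxq : x ∈ q.support) :
    x = u ∨ x = v := by
  obtain ⟨p₁, p₂, hp₁, hp₂, rfl⟩ := hp.mem_support_iff_exists_append.mp hxp
  obtain ⟨q₁, q₂, hq₁, hq₂, rfl⟩ := hq.mem_support_iff_exists_append.mp hxq
  by_contra! hx
  have l₁ : p₁.length ≠ 0 := fun h => hx.1 (eq_of_length_eq_zero h).symm
  have l₂ : p₂.length ≠ 0 := fun h => hx.2 (eq_of_length_eq_zero h)
  have l₃ : q₁.length ≠ 0 := fun h => hx.1 (eq_of_length_eq_zero h).symm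
  have l₄ : q₂.length ≠ 0 := fun h => hx.2 (eq_of_length_eq_zero h)
  simp only [length_append] at hpl hql
  -- The paths differ before `x` or after it. As all four pieces are nonempty, the differing pair
  -- has total length below `2 * ℓ`, yet it contains a cycle.
  by_cases h₁ : p₁ = q₁
  · have h₂ : p₂ ≠ q₂ := fun h₂ => hpq (by rw [h₁, h₂])
    obtain ⟨w, -, -, c, hc, hl⟩ := hp₂.exists_isCycle_length_le_add_of_ne hq₂ h₂
    have := hG w c hc
    omega
  · obtain ⟨w, -, -, c, hc, hl⟩ := hp₁.exists_isCycle_length_le_add_of_ne hq₁ h₁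
    have := hG w c hc
    omega

lemma exists_append_getVert {u v : V} (p : G.Walk u v) {i : ℕ} (hi : i ≤ p.length) :
    ∃ (q : G.Walk u (p.getVert i)) (r : G.Walk (p.getVert i) v), p = q.append r ∧ q.length = i :=
  ⟨p.take i, p.drop i, (p.append_take_drop_eq i).symm, by simp [hi]⟩

/-- A walk reaching a set contains a path that stops at its first vertex in the set. -/
lemma exists_isPath_first_mem {S : Set V} {x y : V} (p : G.Walk x y) (hy : y ∈ S) :
    ∃ z ∈ S, ∃ q : G.Walk x z, q.IsPath ∧ (∀ w ∈ q.support, w ∈ S → w = z) ∧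
      q.support ⊆ p.support ∧ q.toSubgraph ≤ p.toSubgraph := by
  classical
  suffices H : ∃ z ∈ S, ∃ q : G.Walk x z, (∀ w ∈ q.support, w ∈ S → w = z) ∧
      q.support ⊆ p.support ∧ q.toSubgraph ≤ p.toSubgraph by
    obtain ⟨z, hz, q, h1, h2, h3⟩ := H
    exact ⟨z, hz, q.bypass, q.bypass_isPath, fun w hw => h1 w (q.support_bypass_subset_support hw),
      fun w hw => h2 (q.support_bypass_subset_support hw), q.toSubgraph_bypass_le_toSubgraph.trans h3⟩
  induction p with
  | nil => exact ⟨_, hy, nil, by simp, by simp, le_rfl⟩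
  | @cons a b d h p ih =>
    by_cases ha : a ∈ S
    · exact ⟨a, ha, nil, by simp, by simp, by simp⟩
    · obtain ⟨z, hz, q, h1, h2, h3⟩ := ih hy
      refine ⟨z, hz, cons h q, ?_, ?_, ?_⟩
      · intro w hw hwS
        rw [support_cons, List.mem_cons] at hw
        rcases hw with rfl | hw
        · exact absurd hwS ha
        · exact h1 w hw hwS
      · intro w hw
        rw [support_cons, List.mem_cons] at hw
        rcases hw with rfl | hw
        · simp
        · simpa using Or.inr (h2 hw)
      · exact sup_le_sup le_rfl h3

lemma IsCycle.getVert_inj {v : V} {c : G.Walk v v} (hc : c.IsCycle) {i j : ℕ} (hi : i < c.length)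
    (hj : j < c.length) (h : c.getVert i = c.getVert j) : i = j :=
  hc.getVert_injOn' (by simp; omega) (by simp; omega) h

lemma IsCycle.exists_getVert_lt {v : V} {c : G.Walk v v} (hc : c.IsCycle) {x : V}
    (hx : x ∈ c.support) : ∃ i < c.length, c.getVert i = x := by
  obtain ⟨n, hn, hl⟩ := mem_support_iff_exists_getVert.mp hx
  have := hc.three_le_length
  rcases hl.lt_or_eq with h | h
  · exact ⟨n, h, hn⟩
  · exact ⟨0, by omega, by rw [← hn, h]; simp⟩

/-- Two positions on a cycle split it into two arcs. -/
lemma IsCycle.exists_arcs {v : V} {c : G.Walk v v} (hc : c.IsCycle) {i j : ℕ} (hij : i < j)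
    (hj : j < c.length) : ∃ A B : G.Walk (c.getVert i) (c.getVert j),
      A.IsPath ∧ B.IsPath ∧ A.length = j - i ∧ B.length = c.length - (j - i) ∧
      (∀ x ∈ A.support, ∃ n, i ≤ n ∧ n ≤ j ∧ c.getVert n = x) ∧
      (∀ x ∈ B.support, ∃ n < c.length, (n ≤ i ∨ j ≤ n) ∧ c.getVert n = x) ∧
      A.toSubgraph ⊔ B.toSubgraph = c.toSubgraph := by
  obtain ⟨q, r, hqr, hq⟩ := c.exists_append_getVert hj.le
  obtain ⟨q₁, q₂, hq₁₂, hq₁⟩ := q.exists_append_getVert (i := i) (by omega)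
  have key : q.getVert i = c.getVert i := by
    conv_rhs => rw [hqr, getVert_append]
    simp [hq, hij]
  have hql : q₁.length + q₂.length = j := by
    rw [← length_append, ← hq₁₂, hq]
  have hrl : j + r.length = c.length := by conv_rhs => rw [hqr, length_append, hq]
  have hr0 : ¬ r.Nil := by rw [← length_eq_zero_iff]; omega
  have hq0 : ¬ q.Nil := by rw [← length_eq_zero_iff]; omega
  have hqp : q.IsPath := (hqr ▸ hc).isPath_of_append_left hr0
  have hrp : r.IsPath := (hqr ▸ hc).isPath_of_append_right hq0
  have hq₁p : q₁.IsPath := (hq₁₂ ▸ hqp).of_append_left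
  have hq₂p : q₂.IsPath := (hq₁₂ ▸ hqp).of_append_right
  have g₁ : ∀ n ≤ i, q₁.getVert n = c.getVert n := by
    intro n hn
    have e1 : c.getVert n = q.getVert n := by
      conv_lhs => rw [hqr, getVert_append]
      simp [hq, show n < j by omega]
    have e2 : q.getVert n = q₁.getVert n := by
      conv_lhs => rw [hq₁₂, getVert_append']
      simp [hq₁, hn]
    rw [e1, e2]
  have g₂ : ∀ n, n ≤ j - i → q₂.getVert n = c.getVert (i + n) := by
    intro n hn
    have e1 : c.getVert (i + n) = q.getVert (i + n) := by
      conv_lhs => rw [hqr, getVert_append']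
      simp [hq, show i + n ≤ j by omega]
    have e2 : q.getVert (i + n) = q₂.getVert n := by
      conv_lhs => rw [hq₁₂, getVert_append]
      simp [hq₁]
    rw [e1, e2]
  have g₃ : ∀ n, r.getVert n = c.getVert (j + n) := by
    intro n
    conv_rhs => rw [hqr, getVert_append]
    simp [hq]
  have s₁ : ∀ x ∈ q₁.support, ∃ n ≤ i, c.getVert n = x := by
    intro x hx
    obtain ⟨n, hn, hl⟩ := mem_support_iff_exists_getVert.mp hx
    exact ⟨n, by omega, by rw [← hn, g₁ n (by omega)]⟩
  have s₃ : ∀ x ∈ r.support, ∃ n, j ≤ n ∧ n ≤ c.length ∧ c.getVert n = x := by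
    intro x hx
    obtain ⟨n, hn, hl⟩ := mem_support_iff_exists_getVert.mp hx
    exact ⟨j + n, by omega, by omega, by rw [← hn, g₃ n]⟩
  -- The second arc runs through the base point `v`, which is position `c.length` on `r` and
  -- position `0` on `q₁`. Nothing else is shared.
  have hB : (r.append q₁).IsPath := by
    apply hrp.append_of_inter hq₁p
    intro x hx hx'
    obtain ⟨n, hn, hn', rfl⟩ := s₃ x hx
    obtain ⟨k, hk, hkx⟩ := s₁ _ hx'
    rcases hn'.lt_or_eq with h | h
    · have := hc.getVert_inj (by omega) h hkx
      omega
    · rw [h]; simp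
  refine ⟨q₂.copy key rfl, (r.append q₁).reverse.copy key rfl, by simpa using hq₂p,
    by
    rw [isPath_copy, isPath_reverse_iff]; exact hB, by simp; omega, by simp; omega, ?_, ?_, ?_⟩
  · intro x hx
    rw [support_copy] at hx
    obtain ⟨n, hn, hl⟩ := mem_support_iff_exists_getVert.mp hx
    exact ⟨i + n, by omega, by omega, by rw [← hn, g₂ n (by omega)]⟩
  · intro x hx
    rw [support_copy, support_reverse, List.mem_reverse, mem_support_append_iff] at hx
    rcases hx with hx | hx
    · obtain ⟨n, hn, hn', rfl⟩ := s₃ x hx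
      rcases hn'.lt_or_eq with h | h
      · exact ⟨n, h, Or.inr hn, rfl⟩
      · exact ⟨0, by omega, Or.inl (by omega), by rw [h]; simp⟩
    · obtain ⟨n, hn, rfl⟩ := s₁ x hx
      exact ⟨n, by omega, Or.inl hn, rfl⟩
  · have e1 : ∀ {a a' b : V} (p : G.Walk a b) (h : a = a'), (p.copy h rfl).toSubgraph = p.toSubgraph := by
      rintro a _ b p rfl; rfl
    rw [e1, e1, toSubgraph_reverse, toSubgraph_append]
    conv_rhs => rw [hqr, toSubgraph_append, hq₁₂, toSubgraph_append]
    ac_rfl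

end SimpleGraph.Walk

/-! ### Ears of a cycle and their lengths -/

namespace SimpleGraph.Walk

variable {V : Type*} {G : SimpleGraph V}

/-- `q` is an ear of the closed walk `c`: a path between two distinct vertices of `c` that has no
inner vertex on `c` and is not an edge of `c`. -/
structure IsEar {v : V} (c : G.Walk v v) {x y : V} (q : G.Walk x y) : Prop where
  isPath : q.IsPath
  ne : x ≠ y
  left : x ∈ c.support
  right : y ∈ c.support
  inter : ∀ z ∈ q.support, z ∈ c.support → z = x ∨ z = y
  new : ¬ q.toSubgraph ≤ c.toSubgraph

namespace IsEar

variable {v x y x' y' : V} {c : G.Walk v v} {q : G.Walk x y} {p : G.Walk x' y'}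

lemma reverse (h : c.IsEar q) : c.IsEar q.reverse :=
  ⟨h.isPath.reverse, h.ne.symm, h.right, h.left,
    fun z hz hz' => (h.inter z (by simpa using hz) hz').symm, by simpa using h.new⟩

lemma of_notMem_support (hq : q.IsPath) (hxy : x ≠ y) (hx : x ∈ c.support) (hy : y ∈ c.support)
    (hinter : ∀ z ∈ q.support, z ∈ c.support → z = x ∨ z = y) {w : V} (hw : w ∈ q.support)
    (hwc : w ∉ c.support) : c.IsEar q :=
  ⟨hq, hxy, hx, hy, hinter, fun h => hwc (by
    rw [← mem_verts_toSubgraph] at hw ⊢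
    exact h.1 hw)⟩

/-- An ear with ends at distance `d` along the cycle yields two more cycles. -/
lemma exists_isCycle (hc : c.IsCycle) (h : c.IsEar q) :
    ∃ i < c.length, ∃ j < c.length, c.getVert i = x ∧ c.getVert j = y ∧
      ∃ d, (i + d = j ∨ j + d = i) ∧ 0 < d ∧ d < c.length ∧
        (∃ (w : V) (c' : G.Walk w w), c'.IsCycle ∧ c'.length = q.length + d) ∧
        (∃ (w : V) (c' : G.Walk w w), c'.IsCycle ∧ c'.length = q.length + (c.length - d)) := by
  -- The two cycles are the ear closed by either arc. The order `i < j` costs nothing, since an ear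
  -- can be reversed.
  have main : ∀ {i j : ℕ}, i < j → j < c.length → ∀ q : G.Walk (c.getVert i) (c.getVert j),
      c.IsEar q →
        (∃ (w : V) (c' : G.Walk w w), c'.IsCycle ∧ c'.length = q.length + (j - i)) ∧
        (∃ (w : V) (c' : G.Walk w w), c'.IsCycle ∧
          c'.length = q.length + (c.length - (j - i))) := by
    intro i j hij hj q h
    obtain ⟨A, B, hA, hB, hAl, hBl, -, -, hAB⟩ := hc.exists_arcs hij hj
    have hA' : A.toSubgraph ≤ c.toSubgraph := hAB ▸ le_sup_left
    have hB' : B.toSubgraph ≤ c.toSubgraph := hAB ▸ le_sup_right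
    refine ⟨⟨_, _, h.isPath.isCycle_append_reverse hA h.ne ?_ ?_, by simp [hAl]⟩,
      ⟨_, _, h.isPath.isCycle_append_reverse hB h.ne ?_ ?_, by simp [hBl]⟩⟩
    · rintro rfl; exact h.new hA'
    · intro z hz hz'
      exact h.inter z hz (c.mem_verts_toSubgraph.mp (hA'.1 (A.mem_verts_toSubgraph.mpr hz')))
    · rintro rfl; exact h.new hB'
    · intro z hz hz'
      exact h.inter z hz (c.mem_verts_toSubgraph.mp (hB'.1 (B.mem_verts_toSubgraph.mpr hz')))
  obtain ⟨i, hi, rfl⟩ := hc.exists_getVert_lt h.left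
  obtain ⟨j, hj, rfl⟩ := hc.exists_getVert_lt h.right
  refine ⟨i, hi, j, hj, rfl, rfl, ?_⟩
  rcases lt_trichotomy i j with hij | rfl | hij
  · obtain ⟨h1, h2⟩ := main hij hj q h
    exact ⟨j - i, by omega, by omega, by omega, h1, h2⟩
  · exact absurd rfl h.ne
  · obtain ⟨h1, h2⟩ := main hij hi q.reverse h.reverse
    rw [length_reverse] at h1 h2
    exact ⟨i - j, by omega, by omega, by omega, h1, h2⟩

end IsEar

/-- `c` is a cycle in a graph with cycle lengths `c.length` and `2 * ℓ` only, where `2 * ℓ` is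
less than `c.length` if these numbers differ, in which case `c.length` is odd. -/
structure IsEarCycle {v : V} (c : G.Walk v v) (ℓ : ℕ) : Prop where
  isCycle : c.IsCycle
  two_le : 2 ≤ ℓ
  length : c.length = 2 * ℓ ∨ Odd c.length ∧ 2 * ℓ < c.length
  length_cycle : ∀ (w : V) (c' : G.Walk w w), c'.IsCycle →
    c'.length = c.length ∨ c'.length = 2 * ℓ

namespace IsEarCycle

variable {v x y x' y' : V} {c : G.Walk v v} {ℓ : ℕ} {q : G.Walk x y} {p : G.Walk x' y'}

lemma two_mul_le (hc : c.IsEarCycle ℓ) (w : V) (c' : G.Walk w w) (h : c'.IsCycle) :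
    2 * ℓ ≤ c'.length := by
  rcases hc.length_cycle w c' h with h | h <;> rcases hc.length with h' | ⟨-, h'⟩ <;> omega

/-- The two cycles through the ear have lengths summing to `2 * q.length + c.length`. If `c.length =
2 * ℓ`, both have length `2 * ℓ`. If `c.length` is odd, parity forces one of each length. Either way
`q.length = ℓ`, and one of the two arcs has length `ℓ`. -/
lemma ear (hc : c.IsEarCycle ℓ) (hq : c.IsEar q) : q.length = ℓ ∧
    ∃ i < c.length, ∃ j < c.length, c.getVert i = x ∧ c.getVert j = y ∧
      (i + ℓ = j ∨ j + ℓ = i ∨ i + ℓ = j + c.length ∨ j + ℓ = i + c.length) := by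
  obtain ⟨i, hi, j, hj, hx, hy, d, hij, hd, hd', ⟨w₁, c₁, hc₁, hl₁⟩, ⟨w₂, c₂, hc₂, hl₂⟩⟩ :=
    hq.exists_isCycle hc.isCycle
  have h₁ := hc.length_cycle _ _ hc₁
  have h₂ := hc.length_cycle _ _ hc₂
  have h₃ : c.length = 2 * ℓ ∨ c.length % 2 = 1 ∧ 2 * ℓ < c.length := by
    simpa only [Nat.odd_iff] using hc.length
  have : q.length = ℓ ∧ (d = ℓ ∨ d + ℓ = c.length) := by omega
  exact ⟨this.1, i, hi, j, hj, hx, hy, by omega⟩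

lemma ear_pos (hc : c.IsEarCycle ℓ) (hq : c.IsEar q) {i j : ℕ} (hi : i < c.length)
    (hj : j < c.length) (hix : c.getVert i = x) (hjy : c.getVert j = y) :
    i + ℓ = j ∨ j + ℓ = i ∨ i + ℓ = j + c.length ∨ j + ℓ = i + c.length := by
  obtain ⟨-, i', hi', j', hj', rfl, rfl, h⟩ := hc.ear hq
  rw [hc.isCycle.getVert_inj hi hi' hix, hc.isCycle.getVert_inj hj hj' hjy]
  exact h

/-- No vertex outside the cycle is joined to three vertices of the cycle by paths that share only
this vertex. -/
lemma not_star (hc : c.IsEarCycle ℓ) {a b d z : V} {A : G.Walk a z} {B : G.Walk z b}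
    {D : G.Walk d z} (hAB : c.IsEar (A.append B)) (hz : z ∉ c.support) (hD : D.IsPath)
    (hd : d ∈ c.support) (hDc : ∀ w ∈ D.support, w ∈ c.support → w = d)
    (hDA : ∀ w ∈ D.support, w ∈ A.support → w = z)
    (hDB : ∀ w ∈ D.support, w ∈ B.support → w = z) : False := by
  have hA := hAB.isPath.of_append_left
  have hB := hAB.isPath.of_append_right
  have haz : a ≠ z := fun h => hz (h ▸ hAB.left)
  have hbz : b ≠ z := fun h => hz (h ▸ hAB.right)
  have hdz : d ≠ z := fun h => hz (h ▸ hd)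
  have hda : d ≠ a := fun h => hdz (hDA d (by simp) (by simp [h]))
  have hdb : d ≠ b := fun h => hdz (hDB d (by simp) (by simp [h]))
  have hDB' : c.IsEar (D.append B) := by
    refine .of_notMem_support (hD.append_of_inter hB hDB) hdb hd hAB.right ?_ (w := z) (by simp) hz
    intro w hw hwc
    rw [mem_support_append_iff] at hw
    rcases hw with hw | hw
    · exact Or.inl (hDc w hw hwc)
    · rcases hAB.inter w (by simp [hw]) hwc with rfl | rfl
      · exact absurd (hAB.isPath.inter_of_append (by simp) hw) haz
      · exact Or.inr rfl
  have hDA' : c.IsEar (D.append A.reverse) := by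
    refine .of_notMem_support (hD.append_of_inter hA.reverse (by simpa using hDA)) hda hd hAB.left
      ?_ (w := z) (by simp) hz
    intro w hw hwc
    rw [mem_support_append_iff, support_reverse, List.mem_reverse] at hw
    rcases hw with hw | hw
    · exact Or.inl (hDc w hw hwc)
    · rcases hAB.inter w (by simp [hw]) hwc with rfl | rfl
      · exact Or.inr rfl
      · exact absurd (hAB.isPath.inter_of_append hw (by simp)) hbz
  obtain ⟨i, hi, ha⟩ := hc.isCycle.exists_getVert_lt hAB.left
  obtain ⟨j, hj, hb⟩ := hc.isCycle.exists_getVert_lt hAB.right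
  obtain ⟨k, hk, hd'⟩ := hc.isCycle.exists_getVert_lt hd
  have e₁ := hc.ear_pos hAB hi hj ha hb
  have e₂ := hc.ear_pos hDB' hk hj hd' hb
  have e₃ := hc.ear_pos hDA' hk hi hd' ha
  have l₁ := (hc.ear hAB).1
  have l₂ := (hc.ear hDB').1
  have l₃ := (hc.ear hDA').1
  simp only [length_append, length_reverse] at l₁ l₂ l₃
  have hij : i ≠ j := by rintro rfl; exact hAB.ne (ha.symm.trans hb)
  have hkj : k ≠ j := by rintro rfl; exact hdb (hd'.symm.trans hb)
  have hki : k ≠ i := by rintro rfl; exact hda (hd'.symm.trans ha)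
  have h₃ : c.length = 2 * ℓ ∨ c.length % 2 = 1 ∧ 2 * ℓ < c.length := by
    simpa only [Nat.odd_iff] using hc.length
  -- Three distinct positions that pairwise differ by `±ℓ` modulo `c.length` force `c.length = 3 *
  -- ℓ`, so `ℓ` is odd. But the three legs have pairwise sums `ℓ`, hence equal lengths, and `ℓ` is
  -- even.
  omega

/-- Follow `q` from `x` to its first vertex `z` on `p`. If `x` were not an end of `p`, then `z`
would lie off the cycle, and this segment with the two halves of `p` would form a star excluded by
`not_star`. -/
lemma end_mem_of_inter (hc : c.IsEarCycle ℓ) (hq : c.IsEar q) (hp : c.IsEar p) {w : V}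
    (hwq : w ∈ q.support) (hwp : w ∈ p.support) (hw : w ∉ c.support) : x = x' ∨ x = y' := by
  obtain ⟨q₁, q₂, hq₁, hq₂, rfl⟩ := hq.isPath.mem_support_iff_exists_append.mp hwq
  have hq₁c : ∀ u ∈ q₁.support, u ∈ c.support → u = x := by
    intro u hu huc
    rcases hq.inter u (by simp [hu]) huc with rfl | rfl
    · rfl
    · exact absurd (hq.isPath.inter_of_append hu (by simp)) (fun h => hw (h ▸ hq.right))
  by_contra! hx
  obtain ⟨z, hz, D, hD, hDz, hDs, -⟩ := q₁.exists_isPath_first_mem (S := {u | u ∈ p.support}) hwp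
  obtain ⟨A, B, hA, hB, rfl⟩ := hp.isPath.mem_support_iff_exists_append.mp hz
  have hzc : z ∉ c.support := by
    intro hzc
    have := hq₁c z (hDs (by simp)) hzc
    rcases hp.inter z hz hzc with h | h
    · exact hx.1 (by rw [← this, h])
    · exact hx.2 (by rw [← this, h])
  exact hc.not_star hp hzc hD hq.left (fun u hu huc => hq₁c u (hDs hu) huc)
    (fun u hu hu' => hDz u hu (by simp [hu'])) (fun u hu hu' => hDz u hu (by simp [hu']))

/-- Two ears that share a vertex outside the cycle are equal up to reversal. -/
lemma ear_unique (hc : c.IsEarCycle ℓ) (hq : c.IsEar q) (hp : c.IsEar p) {w : V}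
    (hwq : w ∈ q.support) (hwp : w ∈ p.support) (hw : w ∉ c.support) :
    (∃ (hx : x' = x) (hy : y' = y), p.copy hx hy = q) ∨
      ∃ (hx : y' = x) (hy : x' = y), p.reverse.copy hx hy = q := by
  have main : ∀ {p q : G.Walk x y}, c.IsEar q → c.IsEar p → w ∈ q.support → w ∈ p.support →
      p = q := by
    -- With common ends, both ears have length `ℓ`, so the girth bound makes them internally
    -- disjoint unless they are equal.
    intro p q hq hp hwq hwp
    by_contra h
    rcases hp.isPath.inter_of_length_le hc.two_mul_le hq.isPath (hc.ear hp).1.le (hc.ear hq).1.le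
      h hwp hwq with rfl | rfl
    · exact hw hq.left
    · exact hw hq.right
  have h₁ := hc.end_mem_of_inter hq hp hwq hwp hw
  have h₂ := hc.end_mem_of_inter hq.reverse hp (by simpa using hwq) hwp hw
  have := hq.ne
  rcases h₁ with rfl | rfl <;> rcases h₂ with rfl | rfl
  · exact absurd rfl this
  · exact Or.inl ⟨rfl, rfl, main hq hp hwq hwp⟩
  · exact Or.inr ⟨rfl, rfl, main hq hp.reverse hwq (by simpa using hwp)⟩
  · exact absurd rfl this

/-- Two ears do not cross. -/
lemma not_cross (hc : c.IsEarCycle ℓ) {a a' b b' : ℕ} (h₁ : a < a') (h₂ : a' < b) (h₃ : b < b')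
    (h₄ : b' < c.length) {p : G.Walk (c.getVert a) (c.getVert b)}
    {q : G.Walk (c.getVert a') (c.getVert b')} (hp : c.IsEar p) (hq : c.IsEar q) : False := by
  have hinj := fun {i j : ℕ} => hc.isCycle.getVert_inj (i := i) (j := j)
  obtain ⟨A, -, hA, -, hAl, -, hAs, -, hAc⟩ := hc.isCycle.exists_arcs h₁ (by omega)
  obtain ⟨B, -, hB, -, hBl, -, hBs, -, hBc⟩ := hc.isCycle.exists_arcs h₃ h₄
  have hpq : ∀ z ∈ p.support, z ∈ q.support → z ∈ c.support := by
    intro z hzp hzq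
    by_contra hz
    rcases hc.ear_unique hp hq hzp hzq hz with ⟨h, -⟩ | ⟨h, -⟩
    · have := hinj (by omega) (by omega) h; omega
    · have := hinj (by omega) (by omega) h; omega
  have pos : ∀ {i j : ℕ} {r : G.Walk (c.getVert i) (c.getVert j)}, c.IsEar r → i < c.length →
      j < c.length → ∀ n < c.length, c.getVert n ∈ r.support → n = i ∨ n = j := by
    intro i j r hr hi hj n hn h
    rcases hr.inter _ h (c.getVert_mem_support n) with h | h
    · exact Or.inl (hinj hn hi h)
    · exact Or.inr (hinj hn hj h)
  have P : (p.append B).IsPath := by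
    apply hp.isPath.append_of_inter hB
    intro z hz hz'
    obtain ⟨n, hn, hn', rfl⟩ := hBs z hz'
    rcases pos hp (by omega) (by omega) n (by omega) hz with rfl | rfl
    · omega
    · rfl
  have Q : (A.append q).IsPath := by
    apply hA.append_of_inter hq.isPath
    intro z hz hz'
    obtain ⟨n, hn, hn', rfl⟩ := hAs z hz
    rcases pos hq (by omega) (by omega) n (by omega) hz' with rfl | rfl
    · rfl
    · omega
  have hne : c.getVert a ≠ c.getVert b' := fun h => by
    have := hinj (by omega) (by omega) h; omega
  have hPQ : ∀ z ∈ (p.append B).support, z ∈ (A.append q).support →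
      z = c.getVert a ∨ z = c.getVert b' := by
    intro z hz hz'
    rw [mem_support_append_iff] at hz hz'
    rcases hz with hz | hz <;> rcases hz' with hz' | hz'
    · obtain ⟨n, hn, hn', rfl⟩ := hAs z hz'
      rcases pos hp (by omega) (by omega) n (by omega) hz with rfl | rfl
      · exact Or.inl rfl
      · omega
    · obtain ⟨n, hn, rfl⟩ := hc.isCycle.exists_getVert_lt (hpq z hz hz')
      have := pos hp (by omega) (by omega) n (by omega) hz
      have := pos hq (by omega) (by omega) n (by omega) hz'
      omega
    · obtain ⟨n, hn, hn', rfl⟩ := hBs z hz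
      obtain ⟨k, hk, hk', h⟩ := hAs _ hz'
      have := hinj (by omega) (by omega) h
      omega
    · obtain ⟨n, hn, hn', rfl⟩ := hBs z hz
      rcases pos hq (by omega) (by omega) n (by omega) hz' with rfl | rfl
      · omega
      · exact Or.inr rfl
  have hPQne : p.append B ≠ A.append q := by
    intro h
    have : c.getVert b ∈ (A.append q).support := h ▸ by simp
    rcases hPQ _ (by simp) this with h | h
    · have := hinj (by omega) (by omega) h; omega
    · have := hinj (by omega) (by omega) h; omega
  -- This cycle uses both ears and the arcs from `a` to `a'` and from `b` to `b'`, so its length is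
  -- `2 * ℓ + (a' - a) + (b' - b)`, more than `2 * ℓ`. If `b - a = b' - a'`, this number is even.
  -- Otherwise one ear spans `ℓ` positions and the other `c.length - ℓ`, and the total exceeds
  -- `c.length`.
  have hlen := hc.length_cycle _ _ (P.isCycle_append_reverse Q hne hPQne hPQ)
  simp only [length_append, length_reverse, hAl, hBl, (hc.ear hp).1, (hc.ear hq).1] at hlen
  have e₁ := hc.ear_pos hp (by omega) (by omega) rfl rfl
  have e₂ := hc.ear_pos hq (by omega) (by omega) rfl rfl
  have h₃ : c.length = 2 * ℓ ∨ c.length % 2 = 1 ∧ 2 * ℓ < c.length := by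
    simpa only [Nat.odd_iff] using hc.length
  omega

end IsEarCycle

end SimpleGraph.Walk

/-! ### Ears in 2-connected graphs -/

namespace SimpleGraph

open Walk

variable {V : Type*} {G : SimpleGraph V}

lemma Subgraph.exists_walk_of_induce_coe {B : G.Subgraph} {S : Set B.verts} {a b : S}
    (W : (B.coe.induce S).Walk a b) : ∃ w : G.Walk a.1.1 b.1.1, w.toSubgraph ≤ B ∧
      ∀ u ∈ w.support, ∃ hu : u ∈ B.verts, (⟨u, hu⟩ : B.verts) ∈ S := by
  induction W with
  | @nil u => exact ⟨nil, by simp, by simp⟩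
  | @cons a b d h W ih =>
    obtain ⟨w, hw, hw'⟩ := ih
    have hab : B.Adj a.1.1 b.1.1 := h
    refine ⟨cons hab.adj_sub w, sup_le (subgraphOfAdj_le_of_adj B hab) hw, ?_⟩
    intro u hu
    rw [support_cons, List.mem_cons] at hu
    rcases hu with rfl | hu
    · exact ⟨a.1.2, a.2⟩
    · exact hw' u hu

lemma Subgraph.exists_adj_not_adj {B H : G.Subgraph} (hB : B.coe.Connected) (hH : H ≤ B)
    (hne : H ≠ B) (h0 : H.verts.Nonempty) : ∃ x y, x ∈ H.verts ∧ B.Adj x y ∧ ¬ H.Adj x y := by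
  by_contra! hcon
  apply hne
  have hv : B.verts ⊆ H.verts := by
    intro b hb
    obtain ⟨a, ha⟩ := h0
    by_contra hbH
    obtain ⟨W⟩ := hB.preconnected ⟨a, hH.1 ha⟩ ⟨b, hb⟩
    obtain ⟨d, -, hd₁, hd₂⟩ := W.exists_boundary_dart {u | u.1 ∈ H.verts} ha hbH
    exact hd₂ (H.edge_vert (hcon d.fst.1 d.snd.1 hd₁ d.adj).symm)
  exact le_antisymm hH ⟨hv, fun x y h => hcon x y (hv (B.edge_vert h)) h⟩

/-- A proper subgraph with at least two vertices of a 2-connected graph has an ear. -/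
lemma Subgraph.exists_ear {B H : G.Subgraph} (hB : IsTwoConnected B.coe) (hH : H ≤ B)
    (hne : H ≠ B) (h2 : H.verts.Nontrivial) :
    ∃ x ∈ H.verts, ∃ z ∈ H.verts, x ≠ z ∧ ∃ q : G.Walk x z, q.IsPath ∧ q.toSubgraph ≤ B ∧
      (∀ w ∈ q.support, w ∈ H.verts → w = x ∨ w = z) ∧ ¬ q.toSubgraph ≤ H := by
  obtain ⟨x, y, hx, hxy, hnxy⟩ := exists_adj_not_adj hB.2.1 hH hne h2.nonempty
  obtain ⟨t, ht, htx⟩ := h2.exists_ne x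
  -- As `x` is not a cutvertex, `y` is joined to `t` by a walk avoiding `x`. The edge `xy` followed
  -- by this walk up to its first vertex in `H` is the ear. If `y` is already in `H`, the ear is the
  -- edge alone.
  have hcut := hB.2.2 ⟨x, B.edge_vert hxy⟩
  simp only [IsCutvertex, not_exists, not_and, not_not] at hcut
  obtain ⟨W⟩ := hcut ⟨⟨y, B.edge_vert hxy.symm⟩, by simpa [Subtype.ext_iff] using hxy.adj_sub.ne'⟩
    ⟨⟨t, hH.1 ht⟩, by simpa [Subtype.ext_iff] using htx⟩ (hB.2.1.preconnected _ _)
  obtain ⟨w, hwB, hws⟩ := exists_walk_of_induce_coe W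
  obtain ⟨z, hz, q, hq, hqH, hqs, hqw⟩ := w.exists_isPath_first_mem (S := H.verts) ht
  have hxq : x ∉ q.support := by
    intro h
    obtain ⟨hu, hu'⟩ := hws x (hqs h)
    exact hu' rfl
  have hxz : x ≠ z := by rintro rfl; exact hxq (by simp)
  refine ⟨x, hx, z, hz, hxz, cons hxy.adj_sub q, hq.cons hxq,
    sup_le (subgraphOfAdj_le_of_adj B hxy) (hqw.trans hwB), ?_, ?_⟩
  · intro u hu huH
    rw [support_cons, List.mem_cons] at hu
    rcases hu with rfl | hu
    · exact Or.inl rfl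
    · exact Or.inr (hqH u hu huH)
  · intro h
    exact hnxy (h.2 (Or.inl (by simp)))

/-- A single edge is a proper subgraph because there are at least three vertices. An ear of it joins
its two ends, and the two together form a cycle. -/
lemma Subgraph.exists_isCycle {B : G.Subgraph} (hB : IsTwoConnected B.coe) :
    ∃ (v : V) (c : G.Walk v v), c.IsCycle ∧ c.toSubgraph ≤ B := by
  have hnt : B.verts.Nontrivial := by
    rw [← Set.one_lt_encard_iff_nontrivial]
    exact lt_of_lt_of_le (by norm_num) hB.1
  obtain ⟨a, ha, b, hb, hab⟩ := hnt
  obtain ⟨x, y, -, hxy, -⟩ := exists_adj_not_adj (H := G.singletonSubgraph a) hB.2.1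
    (by simpa using ha) (by rintro rfl; simp at hb; exact hab hb.symm) (by simp)
  have hne : G.subgraphOfAdj hxy.adj_sub ≠ B := by
    intro h
    have h3 : (3 : ℕ∞) ≤ B.verts.encard := hB.1
    rw [← h, subgraphOfAdj_verts, Set.encard_pair hxy.adj_sub.ne] at h3
    exact absurd h3 (by norm_num)
  obtain ⟨u, hu, w, hw, huw, q, hq, hqB, hqi, hqn⟩ := exists_ear hB
    (subgraphOfAdj_le_of_adj B hxy) hne ⟨x, by simp, y, by simp, hxy.adj_sub.ne⟩
  simp only [subgraphOfAdj_verts, Set.mem_insert_iff, Set.mem_singleton_iff] at hu hw hqi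
  have huw' : B.Adj u w := by
    rcases hu with rfl | rfl <;> rcases hw with rfl | rfl
    · exact absurd rfl huw
    · exact hxy
    · exact hxy.symm
    · exact absurd rfl huw
  have hsub : huw'.adj_sub.toWalk.toSubgraph = G.subgraphOfAdj hxy.adj_sub := by
    rw [Adj.toSubgraph_toWalk]
    rcases hu with rfl | rfl <;> rcases hw with rfl | rfl
    · exact absurd rfl huw
    · rfl
    · exact subgraphOfAdj_symm _
    · exact absurd rfl huw
  refine ⟨u, _, hq.isCycle_append_reverse huw'.adj_sub.isPath_toWalk huw ?_ ?_, ?_⟩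
  · rintro rfl
    exact hqn hsub.le
  · intro z hz hz'
    simpa using hz'
  · rw [toSubgraph_append, toSubgraph_reverse, Adj.toSubgraph_toWalk]
    exact sup_le hqB (subgraphOfAdj_le_of_adj B huw')

/-- A 2-connected graph is the union of any of its cycles and the ears of that cycle, provided
that ears sharing a vertex outside the cycle have the same vertices. -/
lemma Subgraph.eq_of_ears_le {B H : G.Subgraph} (hB : IsTwoConnected B.coe) {v : V}
    {c : G.Walk v v} (hc : c.IsCycle) (hcH : c.toSubgraph ≤ H) (hHB : H ≤ B)
    (hears : ∀ (x y : V) (q : G.Walk x y), c.IsEar q → q.toSubgraph ≤ B → q.toSubgraph ≤ H)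
    (hdisj : ∀ (x y x' y' : V) (q : G.Walk x y) (p : G.Walk x' y'), c.IsEar q → c.IsEar p →
      ∀ w ∈ q.support, w ∈ p.support → w ∉ c.support → p.support ⊆ q.support) : H = B := by
  set K : G.Subgraph := c.toSubgraph ⊔
    sSup {K | ∃ (x y : V) (q : G.Walk x y), c.IsEar q ∧ q.toSubgraph ≤ B ∧ K = q.toSubgraph}
    with hK
  have hcK : c.toSubgraph ≤ K := le_sup_left
  have hqK : ∀ {x y : V} {q : G.Walk x y}, c.IsEar q → q.toSubgraph ≤ B → q.toSubgraph ≤ K :=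
    fun {x y q} h h' => le_sup_of_le_right (le_sSup ⟨x, y, q, h, h', rfl⟩)
  have hKH : K ≤ H := by
    refine sup_le hcH (sSup_le ?_)
    rintro _ ⟨x, y, q, h, h', rfl⟩
    exact hears x y q h h'
  have hKv : ∀ x ∈ K.verts, x ∉ c.support → ∃ (a b : V) (p : G.Walk a b), c.IsEar p ∧
      p.toSubgraph ≤ B ∧ x ∈ p.support := by
    intro x hx hxc
    rw [hK, Subgraph.verts_sup, Subgraph.verts_sSup] at hx
    rcases hx with hx | hx
    · exact absurd (c.mem_verts_toSubgraph.mp hx) hxc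
    · simp only [Set.mem_iUnion] at hx
      obtain ⟨_, ⟨a, b, p, hp, hpB, rfl⟩, hx⟩ := hx
      exact ⟨a, b, p, hp, hpB, p.mem_verts_toSubgraph.mp hx⟩
  by_contra hne
  have hKB : K ≠ B := fun h => hne (le_antisymm hHB (h ▸ hKH))
  obtain ⟨x, hx, z, hz, hxz, q, hq, hqB, hqi, hqn⟩ := exists_ear hB (hKH.trans hHB) hKB
    ⟨v, hcK.1 (by simp), c.snd, hcK.1 (by simp [getVert_mem_support]),
      (c.adj_snd hc.not_nil).ne⟩
  -- If disjoint paths `A` and `D` in `K` lead from the ends of `q` to distinct vertices of `c`,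
  -- then `A` reversed, `q` and `D` together form an ear of `c`. It lies in `K` by the choice of
  -- `K`, whereas `q` does not. It remains to find `A` and `D` in each case.
  have glue : ∀ {a d : V} (A : G.Walk x a) (D : G.Walk z d), A.IsPath → D.IsPath → a ≠ d →
      a ∈ c.support → d ∈ c.support → (∀ w ∈ A.support, w ∈ c.support → w = a) →
      (∀ w ∈ D.support, w ∈ c.support → w = d) → (∀ w ∈ A.support, w ∉ D.support) →
      A.toSubgraph ≤ K → D.toSubgraph ≤ K → False := by
    intro a d A D hA hD had hac hdc hAc hDc hAD hAK hDK
    have hAv : ∀ w ∈ A.support, w ∈ K.verts := fun w hw => hAK.1 (by simpa using hw)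
    have hDv : ∀ w ∈ D.support, w ∈ K.verts := fun w hw => hDK.1 (by simpa using hw)
    have hqA : ∀ w ∈ A.support, w ∈ q.support → w = x := by
      intro w hw hw'
      rcases hqi w hw' (hAv w hw) with h | rfl
      · exact h
      · exact absurd (by simp) (hAD w hw)
    have hqD : ∀ w ∈ D.support, w ∈ q.support → w = z := by
      intro w hw hw'
      rcases hqi w hw' (hDv w hw) with rfl | h
      · exact absurd hw (hAD w (by simp))
      · exact h
    have hp : (A.reverse.append (q.append D)).IsPath := by
      refine hA.reverse.append_of_inter
        (hq.append_of_inter hD fun w hw hw' => hqD w hw' hw) ?_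
      intro w hw hw'
      rw [support_reverse, List.mem_reverse] at hw
      rw [mem_support_append_iff] at hw'
      rcases hw' with hw' | hw'
      · exact hqA w hw hw'
      · exact absurd hw' (hAD w hw)
    have hsub : (A.reverse.append (q.append D)).toSubgraph =
        A.toSubgraph ⊔ (q.toSubgraph ⊔ D.toSubgraph) := by simp
    have hear : c.IsEar (A.reverse.append (q.append D)) := by
      refine ⟨hp, had, hac, hdc, ?_, ?_⟩
      · intro w hw hwc
        rw [mem_support_append_iff, mem_support_append_iff, support_reverse,
          List.mem_reverse] at hw
        rcases hw with hw | hw | hw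
        · exact Or.inl (hAc w hw hwc)
        · rcases hqi w hw (hcK.1 (by simpa using hwc)) with rfl | rfl
          · exact Or.inl (hAc w (by simp) hwc)
          · exact Or.inr (hDc w (by simp) hwc)
        · exact Or.inr (hDc w hw hwc)
      · intro h
        rw [hsub] at h
        exact hqn ((le_sup_left.trans le_sup_right).trans (h.trans hcK))
    have := hqK hear (hsub ▸ sup_le (hAK.trans (hKH.trans hHB))
      (sup_le hqB (hDK.trans (hKH.trans hHB))))
    rw [hsub] at this
    exact hqn ((le_sup_left.trans le_sup_right).trans this)
  -- An inner vertex of an ear can leave along it in two directions, so the end reached on `c` can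
  -- be chosen to avoid any given `d`.
  have tail : ∀ {x a b : V} {p : G.Walk a b}, c.IsEar p → p.toSubgraph ≤ B → x ∈ p.support →
      x ∉ c.support → ∀ d, ∃ e, e ≠ d ∧ e ∈ c.support ∧ ∃ A : G.Walk x e, A.IsPath ∧
        (∀ w ∈ A.support, w ∈ c.support → w = e) ∧ A.toSubgraph ≤ K ∧
        A.support ⊆ p.support := by
    have main : ∀ {x a b : V} {p : G.Walk a b}, c.IsEar p → p.toSubgraph ≤ B → x ∈ p.support →
        x ∉ c.support → ∃ A : G.Walk x b, A.IsPath ∧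
        (∀ w ∈ A.support, w ∈ c.support → w = b) ∧ A.toSubgraph ≤ K ∧
        A.support ⊆ p.support := by
      intro x a b p hp hpB hxp hxc
      have hpK := hqK hp hpB
      obtain ⟨p₁, p₂, hp₁, hp₂, rfl⟩ := hp.isPath.mem_support_iff_exists_append.mp hxp
      refine ⟨p₂, hp₂, ?_, le_trans (by simp) hpK, fun w hw => by simp [hw]⟩
      intro w hw hwc
      rcases hp.inter w (by simp [hw]) hwc with rfl | rfl
      · exact absurd hp.left (hp.isPath.inter_of_append (by simp) hw ▸ hxc)
      · rfl
    intro x a b p hp hpB hxp hxc d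
    by_cases hd : b = d
    · obtain ⟨A, h₁, h₂, h₃, h₄⟩ := main hp.reverse (by simpa using hpB) (by simpa using hxp) hxc
      exact ⟨a, hd ▸ hp.ne, hp.left, A, h₁, h₂, h₃, by simpa using h₄⟩
    · obtain ⟨A, h⟩ := main hp hpB hxp hxc
      exact ⟨b, hd, hp.right, A, h⟩
  have nilK : ∀ {u : V}, u ∈ c.support → (nil : G.Walk u u).toSubgraph ≤ K := by
    intro u hu
    simpa using hcK.1 (c.mem_verts_toSubgraph.mpr hu)
  by_cases hxc : x ∈ c.support <;> by_cases hzc : z ∈ c.support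
  · exact glue nil nil .nil .nil hxz hxc hzc (by simp) (by simp) (by simpa using hxz) (nilK hxc)
      (nilK hzc)
  · obtain ⟨a, b, p, hp, hpB, hzp⟩ := hKv z hz hzc
    obtain ⟨d, hd, hdc, D, h₁, h₂, h₃, -⟩ := tail hp hpB hzp hzc x
    refine glue nil D .nil h₁ hd.symm hxc hdc (by simp) h₂ ?_ (nilK hxc) h₃
    simp only [support_nil, List.mem_singleton, forall_eq]
    exact fun h => hd (h₂ x h hxc).symm
  · obtain ⟨a, b, p, hp, hpB, hxp⟩ := hKv x hx hxc
    obtain ⟨d, hd, hdc, D, h₁, h₂, h₃, -⟩ := tail hp hpB hxp hxc z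
    refine glue D nil h₁ .nil hd hdc hzc h₂ (by simp) ?_ h₃ (nilK hzc)
    simp only [support_nil, List.mem_singleton]
    rintro w hw rfl
    exact hd (h₂ w hw hzc).symm
  · obtain ⟨a, b, p, hp, hpB, hxp⟩ := hKv x hx hxc
    obtain ⟨a', b', p', hp', hpB', hzp'⟩ := hKv z hz hzc
    by_cases hzp : z ∈ p.support
    -- Here `x` and `z` lie on the same ear, which is followed from them in opposite directions.
    · have main : ∀ {a b : V} {p : G.Walk a b} {p₁ : G.Walk a x} {p₂ : G.Walk x b}, c.IsEar p →
          p.toSubgraph ≤ B → p = p₁.append p₂ → z ∈ p₂.support → False := by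
        rintro a b _ p₁ p₂ hp hpB rfl hzp₂
        have hpK := hqK hp hpB
        have hp₂ := hp.isPath.of_append_right
        obtain ⟨p₃, p₄, hp₃, hp₄, rfl⟩ := hp₂.mem_support_iff_exists_append.mp hzp₂
        have hxp₄ : x ∉ p₄.support := fun h => hxz (hp₂.inter_of_append (by simp) h)
        have hdis : ∀ w ∈ p₁.support, w ∉ p₄.support := by
          intro w hw hw'
          have := hp.isPath.inter_of_append hw (by simp [hw'])
          exact hxp₄ (this ▸ hw')
        refine glue p₁.reverse p₄ hp.isPath.of_append_left.reverse hp₄ hp.ne hp.left hp.right ?_ ?_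
          (by simpa using hdis) (le_trans (by simp) hpK)
          (le_trans (by simp only [toSubgraph_append]; exact le_sup_right.trans le_sup_right) hpK)
        · intro w hw hwc
          rw [support_reverse, List.mem_reverse] at hw
          rcases hp.inter w (by simp [hw]) hwc with rfl | rfl
          · rfl
          · exact absurd (by simp) (hdis _ hw)
        · intro w hw hwc
          rcases hp.inter w (by simp [hw]) hwc with rfl | rfl
          · exact absurd hw (hdis _ (by simp))
          · rfl
      obtain ⟨p₁, p₂, -, -, hpe⟩ := hp.isPath.mem_support_iff_exists_append.mp hxp
      rcases (mem_support_append_iff _ _).mp (hpe ▸ hzp) with h | h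
      · exact main hp.reverse (by simpa using hpB) (by rw [hpe, reverse_append]) (by simpa using h)
      · exact main hp hpB hpe h
    -- Since `z` is not on `p`, `hdisj` keeps `p` and `p'` disjoint off `c`. Choosing distinct ends
    -- on `c` makes the tails disjoint.
    · obtain ⟨d, -, hdc, D, h₁, h₂, h₃, h₄⟩ := tail hp' hpB' hzp' hzc x
      obtain ⟨e, he, hec, E, k₁, k₂, k₃, k₄⟩ := tail hp hpB hxp hxc d
      refine glue E D k₁ h₁ he hec hdc k₂ h₂ ?_ k₃ h₃
      intro w hw hw'
      by_cases hwc : w ∈ c.support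
      · exact he ((k₂ w hw hwc).symm.trans (h₂ w hw' hwc))
      · exact hzp (hdisj _ _ _ _ p p' hp hp' w (k₄ hw) (h₄ hw') hwc hzp')

end SimpleGraph

/-! ### Structure of blocks: cycles, theta graphs, cycles with thetas -/

namespace SimpleGraph

open Walk

variable {V : Type*} {G : SimpleGraph V}

/-- Needed to index families of paths by `Fin`. A path is determined by its support, a list without
repetitions. -/
lemma Walk.finite_isPath [Finite V] {u v : V} (P : G.Walk u v → Prop)
    (hP : ∀ p, P p → p.IsPath) : Finite {p : G.Walk u v // P p} := by
  classical
  have := Fintype.ofFinite V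
  have h : {l : List V | l.length ≤ Fintype.card V}.Finite := List.finite_length_le V _
  have := h.to_subtype
  refine Finite.of_injective (β := {l : List V | l.length ≤ Fintype.card V})
    (fun p => ⟨p.1.support, (hP _ p.2).support_nodup.length_le_card⟩) ?_
  intro p q hpq
  exact Subtype.ext (Walk.ext_support (congrArg Subtype.val hpq))

/-- A version of `IsEarCycle.not_cross` with free ends. -/
lemma Walk.IsEarCycle.not_cross_of_eq {v : V} {c : G.Walk v v} {ℓ : ℕ} (hc : c.IsEarCycle ℓ)
    {x y x' y' : V} {p : G.Walk x y} {q : G.Walk x' y'} (hp : c.IsEar p) (hq : c.IsEar q)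
    {a a' b b' : ℕ} (hx : c.getVert a = x) (hy : c.getVert b = y) (hx' : c.getVert a' = x')
    (hy' : c.getVert b' = y') (h₁ : a < a') (h₂ : a' < b) (h₃ : b < b') (h₄ : b' < c.length) :
    False := by
  subst hx hy hx' hy'
  exact hc.not_cross h₁ h₂ h₃ h₄ hp hq

lemma Walk.IsEarCycle.support_subset {v : V} {c : G.Walk v v} {ℓ : ℕ} (hc : c.IsEarCycle ℓ)
    {x y x' y' : V} {q : G.Walk x y} {p : G.Walk x' y'} (hq : c.IsEar q) (hp : c.IsEar p) {w : V}
    (hwq : w ∈ q.support) (hwp : w ∈ p.support) (hw : w ∉ c.support) :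
    p.support ⊆ q.support := by
  rcases hc.ear_unique hq hp hwq hwp hw with ⟨rfl, rfl, rfl⟩ | ⟨rfl, rfl, rfl⟩ <;> simp

/-- The two cycles through an ear would have lengths with odd sum, so one would be even. Hence `c`
has no ear. -/
lemma Subgraph.isCycleOfLength_of_odd {B : G.Subgraph} (hB : IsTwoConnected B.coe)
    (hodd : ∀ (v : V) (c : G.Walk v v), c.IsCycle → Odd c.length) {v : V} {c : G.Walk v v}
    (hc : c.IsCycle) (hcB : c.toSubgraph ≤ B) : c.toSubgraph = B := by
  have no_ear : ∀ (x y : V) (q : G.Walk x y), ¬ c.IsEar q := by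
    intro x y q hq
    obtain ⟨i, -, j, -, -, -, d, -, -, hd, ⟨w₁, c₁, hc₁, hl₁⟩, ⟨w₂, c₂, hc₂, hl₂⟩⟩ :=
      hq.exists_isCycle hc
    have h := Nat.odd_iff.mp (hodd _ _ hc)
    have h₁ := Nat.odd_iff.mp (hodd _ _ hc₁)
    have h₂ := Nat.odd_iff.mp (hodd _ _ hc₂)
    omega
  exact eq_of_ears_le hB hc le_rfl hcB (fun x y q hq => absurd hq (no_ear x y q))
    (fun x y _ _ q _ hq => absurd hq (no_ear x y q))

/-- Ears join antipodal vertices of `c`, and two different antipodal pairs interleave. By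
`not_cross`, all ears share one pair of ends, and the two arcs of `c` are paths of length `ℓ`
between the same ends. -/
lemma Subgraph.exists_isTheta [Finite V] {B : G.Subgraph} (hB : IsTwoConnected B.coe) {ℓ : ℕ}
    {v : V} {c : G.Walk v v} (hc : c.IsEarCycle ℓ) (hlen : c.length = 2 * ℓ)
    (hcB : c.toSubgraph ≤ B) : ∃ r, 2 ≤ r ∧ IsTheta B r ℓ := by
  have h2 := hc.two_le
  have hinj := fun {i j : ℕ} => hc.isCycle.getVert_inj (i := i) (j := j)
  have ear_ends : ∀ {x y : V} {q : G.Walk x y}, c.IsEar q → ∃ i, i + ℓ < c.length ∧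
      (c.getVert i = x ∧ c.getVert (i + ℓ) = y ∨ c.getVert i = y ∧ c.getVert (i + ℓ) = x) := by
    intro x y q hq
    obtain ⟨-, i, hi, j, hj, hix, hjy, h⟩ := hc.ear hq
    rcases (by omega : i + ℓ = j ∨ j + ℓ = i) with rfl | rfl
    · exact ⟨i, hj, Or.inl ⟨hix, hjy⟩⟩
    · exact ⟨j, hi, Or.inr ⟨hjy, hix⟩⟩
  obtain ⟨i, hi, hends⟩ : ∃ i, i + ℓ < c.length ∧ ∀ (x y : V) (q : G.Walk x y), c.IsEar q →
      c.getVert i = x ∧ c.getVert (i + ℓ) = y ∨ c.getVert i = y ∧ c.getVert (i + ℓ) = x := by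
    by_cases h : ∃ (x y : V) (q : G.Walk x y), c.IsEar q
    · have dir : ∀ {x y : V} {q : G.Walk x y}, c.IsEar q → ∃ i, i + ℓ < c.length ∧
          ∃ (q' : G.Walk (c.getVert i) (c.getVert (i + ℓ))), c.IsEar q' ∧
          (c.getVert i = x ∧ c.getVert (i + ℓ) = y ∨
            c.getVert i = y ∧ c.getVert (i + ℓ) = x) := by
        intro x y q hq
        obtain ⟨i, hi, ⟨rfl, rfl⟩ | ⟨rfl, rfl⟩⟩ := ear_ends hq
        · exact ⟨i, hi, q, hq, Or.inl ⟨rfl, rfl⟩⟩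
        · exact ⟨i, hi, q.reverse, hq.reverse, Or.inr ⟨rfl, rfl⟩⟩
      obtain ⟨x, y, q, hq⟩ := h
      obtain ⟨i, hi, q', hq', -⟩ := dir hq
      refine ⟨i, hi, ?_⟩
      intro x y p hp
      obtain ⟨k, hk, p', hp', h⟩ := dir hp
      rcases lt_trichotomy i k with hik | rfl | hik
      · exact (hc.not_cross hik (by omega) (by omega) hk hq' hp').elim
      · exact h
      · exact (hc.not_cross hik (by omega) (by omega) hi hp' hq').elim
    · push Not at h
      -- Without ears, any antipodal pair serves.
      exact ⟨0, by omega, fun x y q hq => absurd hq (h x y q)⟩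
  obtain ⟨A, A', hA, hA', hAl, hAl', hAs, hAs', hAA⟩ :=
    hc.isCycle.exists_arcs (i := i) (j := i + ℓ) (by omega) hi
  have hne : c.getVert i ≠ c.getVert (i + ℓ) := fun h => by
    have := hinj (by omega) hi h; omega
  -- The arcs share only their ends, and `A.getVert 1` is an inner vertex because `2 ≤ ℓ`.
  have hAne : A ≠ A' := by
    rintro rfl
    have hA1 : A.getVert 1 ∈ A.support := A.getVert_mem_support 1
    obtain ⟨n, h₁, h₂, h₃⟩ := hAs _ hA1
    obtain ⟨k, h₄, h₅, h₆⟩ := hAs' _ hA1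
    obtain rfl := hinj (by omega) (by omega) (h₃.trans h₆.symm)
    rcases (by omega : n = i ∨ n = i + ℓ) with rfl | rfl
    · have := hA.getVert_injOn (by simp; omega) (by simp) (h₃.symm.trans A.getVert_zero.symm)
      omega
    · have := hA.getVert_injOn (by simp; omega) (by simp)
        (h₃.symm.trans A.getVert_length.symm)
      omega
  let P := {p : G.Walk (c.getVert i) (c.getVert (i + ℓ)) //
    p.IsPath ∧ p.length = ℓ ∧ p.toSubgraph ≤ B}
  have : Finite P := Walk.finite_isPath _ fun p hp => hp.1
  let e := Finite.equivFin P
  have hAP : A.IsPath ∧ A.length = ℓ ∧ A.toSubgraph ≤ B :=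
    ⟨hA, by omega, le_sup_left.trans (hAA.le.trans hcB)⟩
  have hAP' : A'.IsPath ∧ A'.length = ℓ ∧ A'.toSubgraph ≤ B :=
    ⟨hA', by omega, le_sup_right.trans (hAA.le.trans hcB)⟩
  have hle : ∀ (p : G.Walk (c.getVert i) (c.getVert (i + ℓ))), p.IsPath → p.length = ℓ →
      p.toSubgraph ≤ B → p.toSubgraph ≤ ⨆ a, ((e.symm a).1).toSubgraph := by
    intro p h₁ h₂ h₃
    refine le_iSup_of_le (e ⟨p, h₁, h₂, h₃⟩) ?_
    simp
  refine ⟨Nat.card P, ?_, c.getVert i, c.getVert (i + ℓ), fun a => (e.symm a).1, hne, ?_, ?_, ?_, ?_⟩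
  · exact Finite.one_lt_card_iff_nontrivial.mpr
      ⟨⟨A, hAP⟩, ⟨A', hAP'⟩, fun h => hAne (congrArg Subtype.val h)⟩
  · exact fun a => ⟨(e.symm a).2.1, (e.symm a).2.2.1⟩
  · exact Subtype.val_injective.comp e.symm.injective
  · intro a b hab x hxa hxb
    refine (e.symm a).2.1.inter_of_length_le hc.two_mul_le (e.symm b).2.1 (e.symm a).2.2.1.le
      (e.symm b).2.2.1.le ?_ hxa hxb
    exact fun h => hab (e.symm.injective (Subtype.ext h))
  · symm
    refine eq_of_ears_le hB hc.isCycle ?_ ?_ ?_ fun _ _ _ _ q p hq hp w => hc.support_subset hq hp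
    · rw [← hAA]
      exact sup_le (hle A hAP.1 hAP.2.1 hAP.2.2) (hle A' hAP'.1 hAP'.2.1 hAP'.2.2)
    · exact iSup_le fun a => (e.symm a).2.2.2
    · intro x y q hq hqB
      have hql := (hc.ear hq).1
      rcases hends x y q hq with ⟨rfl, rfl⟩ | ⟨rfl, rfl⟩
      · exact hle q hq.isPath hql hqB
      · simpa using hle q.reverse hq.isPath.reverse (by simpa using hql) (by simpa using hqB)

/-- Each ear is directed so that it advances by `ℓ` modulo `c.length`. The set `s` consists of the
positions where an ear in `B` starts. -/
lemma Subgraph.isCycleWithThetas [Finite V] {B : G.Subgraph} (hB : IsTwoConnected B.coe) {ℓ : ℕ}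
    {v : V} {c : G.Walk v v} (hc : c.IsEarCycle ℓ) (hlen : 2 * ℓ < c.length)
    (hcB : c.toSubgraph ≤ B) : IsCycleWithThetas B c.length ℓ := by
  classical
  have hinj := fun {i j : ℕ} => hc.isCycle.getVert_inj (i := i) (j := j)
  have hmod : ∀ i < c.length, i + ℓ < c.length ∧ (i + ℓ) % c.length = i + ℓ ∨
      c.length ≤ i + ℓ ∧ (i + ℓ) % c.length = i + ℓ - c.length := by
    intro i hi
    rcases lt_or_ge (i + ℓ) c.length with h | h
    · exact Or.inl ⟨h, Nat.mod_eq_of_lt h⟩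
    · exact Or.inr ⟨h, by rw [Nat.mod_eq_sub_mod h, Nat.mod_eq_of_lt (by omega)]⟩
  let P : ℕ → Type _ := fun i =>
    {p : G.Walk (c.getVert i) (c.getVert ((i + ℓ) % c.length)) // c.IsEar p ∧ p.toSubgraph ≤ B}
  have (i : ℕ) : Finite (P i) := Walk.finite_isPath _ fun p hp => hp.1.isPath
  let e : ∀ i, P i ≃ Fin (Nat.card (P i)) := fun i => Finite.equivFin (P i)
  have hdir : ∀ (x y : V) (q : G.Walk x y), c.IsEar q → ∃ i < c.length,
      (c.getVert i = x ∧ c.getVert ((i + ℓ) % c.length) = y) ∨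
      (c.getVert i = y ∧ c.getVert ((i + ℓ) % c.length) = x) := by
    intro x y q hq
    obtain ⟨-, i, hi, j, hj, hix, hjy, h⟩ := hc.ear hq
    have hi' := hmod i hi
    have hj' := hmod j hj
    rcases (by omega : (i + ℓ) % c.length = j ∨ (j + ℓ) % c.length = i) with h | h
    · exact ⟨i, hi, Or.inl ⟨hix, by rw [h, hjy]⟩⟩
    · exact ⟨j, hj, Or.inr ⟨hjy, by rw [h, hix]⟩⟩
  refine ⟨v, c, (Finset.range c.length).filter (fun i => Nonempty (P i)),
    fun i => Nat.card (P i), fun i a => ((e i).symm a).1, hc.isCycle, rfl, ?_, ?_, ?_, ?_, ?_, ?_⟩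
  · intro i hi
    simpa using (Finset.mem_filter.mp hi).1
  · intro i hi j hj hij
    obtain ⟨hi, ⟨p, hp, -⟩⟩ := Finset.mem_filter.mp hi
    obtain ⟨hj, ⟨q, hq, -⟩⟩ := Finset.mem_filter.mp hj
    rw [Finset.mem_range] at hi hj
    by_contra hcon
    -- Starting positions too close would make the ears cross. The cases record which ear passes the
    -- base point; such an ear is reversed so that its ends appear in increasing order.
    rcases hmod i hi with ⟨hi₁, hi₂⟩ | ⟨hi₁, hi₂⟩ <;>
    rcases hmod j hj with ⟨hj₁, hj₂⟩ | ⟨hj₁, hj₂⟩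
    · exact hc.not_cross_of_eq hp hq rfl rfl rfl rfl hij (by omega) (by omega) (by omega)
    · by_cases hji : j < i + ℓ
      · exact hc.not_cross_of_eq hq.reverse hp rfl rfl rfl rfl (by omega) hij (by omega) (by omega)
      · exact hc.not_cross_of_eq hp hq.reverse rfl rfl rfl rfl (by omega) (by omega) (by omega) hj
    · omega
    · exact hc.not_cross_of_eq hp.reverse hq.reverse rfl rfl rfl rfl (by omega) (by omega) hij hj
  · exact fun i a => ⟨((e i).symm a).2.1.isPath, (hc.ear ((e i).symm a).2.1).1⟩
  · exact fun i a x hx hxc => ((e i).symm a).2.1.inter x hx hxc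
  · rintro ⟨i, hi⟩ a ⟨j, hj⟩ b hne x hxa hxb
    by_contra hx
    have hi' := Finset.mem_range.mp (Finset.mem_filter.mp hi).1
    have hj' := Finset.mem_range.mp (Finset.mem_filter.mp hj).1
    have hil := hmod i hi'
    have hjl := hmod j hj'
    rcases hc.ear_unique ((e i).symm a).2.1 ((e j).symm b).2.1 hxa hxb hx with
      ⟨h₁, h₂, h₃⟩ | ⟨h₁, h₂, -⟩
    · obtain rfl := hinj hj' hi' h₁
      apply hne
      have : (e j).symm b = (e j).symm a := Subtype.ext h₃
      rw [(e j).symm.injective this]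
    -- An ear advancing by `ℓ` in both directions would make `c.length` divide `2 * ℓ`, against
    -- `hlen`.
    · have : (j + ℓ) % c.length = i := hinj (Nat.mod_lt _ (by omega)) hi' h₁
      rw [this] at hjl
      have : j = (i + ℓ) % c.length := hinj hj' (Nat.mod_lt _ (by omega)) h₂
      rw [← this] at hil
      have := hc.two_le
      omega
  · symm
    refine eq_of_ears_le hB hc.isCycle le_sup_left ?_ ?_
      fun _ _ _ _ q p hq hp w => hc.support_subset hq hp
    · exact sup_le hcB (iSup_le fun i => iSup_le fun a => ((e i).symm a).2.2)
    · have hle : ∀ i < c.length, ∀ p : G.Walk (c.getVert i) (c.getVert ((i + ℓ) % c.length)),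
          c.IsEar p → p.toSubgraph ≤ B → p.toSubgraph ≤ ⨆ i : {x //
            x ∈ (Finset.range c.length).filter (fun i => Nonempty (P i))},
            ⨆ a, (((e i).symm a).1).toSubgraph := by
        intro i hi p hp hpB
        refine le_iSup_of_le ⟨i, by simpa using ⟨hi, ⟨p, hp, hpB⟩⟩⟩
          (le_iSup_of_le (e i ⟨p, hp, hpB⟩) ?_)
        simp
      intro x y q hq hqB
      refine le_sup_of_le_right ?_
      obtain ⟨i, hi, ⟨rfl, rfl⟩ | ⟨rfl, rfl⟩⟩ := hdir x y q hq
      · exact hle i hi q hq hqB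
      · simpa using hle i hi q.reverse hq.reverse (by simpa using hqB)

/-! ### Passing to the graph with only the edges of a block -/

lemma Walk.toSubgraph_mapLe_adj {G' : SimpleGraph V} (h : G' ≤ G) {u v : V} (p : G'.Walk u v)
    {x y : V} : (p.mapLe h).toSubgraph.Adj x y ↔ p.toSubgraph.Adj x y := by
  simp [adj_toSubgraph_iff_mem_edges]

/-- A subgraph `B` seen as a subgraph of the graph that has only the edges of `B`. -/
def Subgraph.inSpanningCoe (B : G.Subgraph) : B.spanningCoe.Subgraph where
  verts := B.verts
  Adj := B.Adj
  adj_sub h := h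
  edge_vert h := B.edge_vert h
  symm := B.symm

lemma Subgraph.isTheta_of_inSpanningCoe {B : G.Subgraph} {r ℓ : ℕ}
    (h : IsTheta B.inSpanningCoe r ℓ) : IsTheta B r ℓ := by
  obtain ⟨u, v, p, huv, hp, hinj, hdisj, heq⟩ := h
  have hle := B.spanningCoe_le
  refine ⟨u, v, fun a => (p a).mapLe hle, huv, fun a => ⟨(hp a).1.mapLe hle, ?_⟩, ?_, ?_, ?_⟩
  · simpa using (hp a).2
  · intro a b hab
    refine hinj (Walk.ext_support ?_)
    simpa using congrArg Walk.support hab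
  · intro a b hab x hxa hxb
    exact hdisj a b hab x (by simpa using hxa) (by simpa using hxb)
  · have hv : B.verts = B.inSpanningCoe.verts := rfl
    have ha : B.Adj = B.inSpanningCoe.Adj := rfl
    ext x y
    · rw [hv, heq]
      simp
    · rw [ha, heq]
      simp only [Subgraph.iSup_adj, Walk.toSubgraph_mapLe_adj]

end SimpleGraph

/-! ### The main theorem -/

open SimpleGraph in
theorem theorem1 {V : Type*} [Finite V] (G : SimpleGraph V) :
    (∀ L : Set ℕ, (∀ m ∈ L, 3 ≤ m ∧ Odd m) → IsLCycleGraph G L →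
      ∀ B : G.Subgraph, IsTwoConnectedBlock B → ∃ m ∈ L, IsCycleOfLength B m) ∧
    (∀ k : ℕ, 2 ≤ k → IsLCycleGraph G {2 * k} →
      ∀ B : G.Subgraph, IsTwoConnectedBlock B → ∃ r, 2 ≤ r ∧ IsTheta B r k) ∧
    (∀ k ℓ : ℕ, 2 ≤ ℓ → 2 * ℓ < 2 * k + 1 → IsLCycleGraph G {2 * k + 1, 2 * ℓ} →
      ∀ B : G.Subgraph, IsTwoConnectedBlock B →
        (∃ r, 2 ≤ r ∧ IsTheta B r ℓ) ∨ IsCycleWithThetas B (2 * k + 1) ℓ) := by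
  have even : ∀ {G : SimpleGraph V} {k : ℕ}, 2 ≤ k → IsLCycleGraph G {2 * k} →
      ∀ B : G.Subgraph, IsTwoConnected B.coe → ∃ r, 2 ≤ r ∧ IsTheta B r k := by
    intro G k hk hG B hB
    obtain ⟨v, c, hc, hcB⟩ := Subgraph.exists_isCycle hB
    have hl : c.length = 2 * k := hG v c hc
    exact Subgraph.exists_isTheta hB ⟨hc, hk, Or.inl hl, fun w c' hc' => Or.inr (hG w c' hc')⟩
      hl hcB
  refine ⟨?_, fun k hk hG B hB => even hk hG B hB.2, ?_⟩
  · intro L hL hG B hB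
    obtain ⟨v, c, hc, hcB⟩ := Subgraph.exists_isCycle hB.2
    refine ⟨c.length, hG v c hc, v, c, hc, rfl, ?_⟩
    exact (Subgraph.isCycleOfLength_of_odd hB.2 (fun w c' hc' => (hL _ (hG w c' hc')).2) hc
      hcB).symm
  · intro k ℓ hℓ hkℓ hG B hB
    by_cases h : ∃ (v : V) (c : G.Walk v v), c.IsCycle ∧ c.toSubgraph ≤ B ∧ c.length = 2 * k + 1
    · obtain ⟨v, c, hc, hcB, hl⟩ := h
      right
      rw [← hl] at hkℓ ⊢
      refine Subgraph.isCycleWithThetas hB.2 ⟨hc, hℓ, Or.inr ⟨⟨k, hl⟩, hkℓ⟩, fun w c' hc' => ?_⟩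
        hkℓ hcB
      rw [hl]
      exact hG w c' hc'
    · push Not at h
      left
      -- Other blocks of `G` may contain cycles of length `2 * k + 1`, so the even case is applied
      -- to the graph formed by the edges of `B` alone.
      have hG' : IsLCycleGraph B.spanningCoe {2 * ℓ} := by
        intro v c hc
        have hle : (c.mapLe B.spanningCoe_le).toSubgraph ≤ B := by
          rw [Walk.toSubgraph_le_iff (by simpa using hc.not_nil)]
          intro e he
          rw [Walk.edgeSet_mapLe_eq_edgeSet] at he
          exact Subgraph.edgeSet_spanningCoe B ▸ c.edges_subset_edgeSet he
        have hc' := hc.mapLe B.spanningCoe_le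
        have := h v _ hc' hle
        have := (hG v _ hc').resolve_left this
        simpa using this
      -- `B.inSpanningCoe.coe` is `B.coe` by definition, so `hB.2` applies unchanged.
      obtain ⟨r, hr, hT⟩ := even hℓ hG' B.inSpanningCoe hB.2
      exact ⟨r, hr, Subgraph.isTheta_of_inSpanningCoe hT⟩
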